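/- Let $T$ be a complete first-order theory in a language $\mathcal L$, let $\mathfrak C$ be a monster model of $T$ ($\kappa$-saturated and strongly $\kappa$-homogeneous for an infinite cardinal $\kappa>|\mathcal L|$; "small" means of cardinality $<\kappa$), let $M\preceq\mathfrak C$ be small and let $M\preceq N\preceq\mathfrak C$ (possibly $N=M$ or $N=\mathfrak C$). Let $\bar n$ be a tuple enumerating $N$, with variables $\bar x$, and let $\bar m\subseteq\bar n$ be a subtuple enumerating $M$, with corresponding variables $\bar x'\subseteq\bar x$; let $\bar y'$ be a copy of $\bar x'$. Let $S_{\bar n}(\mathfrak C)$ be the compact space of complete types over $\mathfrak C$ in variables $\bar x$ extending $\mathrm{tp}(\bar n/\emptyset)$, and let $S^{\mathrm{inv}}_{\bar n}(\mathfrak C,M)$ be the set of those that are $\mathrm{Aut}(\mathfrak C/M)$-invariant. For a finite tuple $\bar b$ from $\mathfrak C$, let $h_{\bar b}\colon S_{\bar n}(\mathfrak C)\to S_{\bar y}(N)$ be the map with $\theta(\bar n;\bar y)\in h_{\bar b}(q)\iff\theta(\bar x;\bar b)\in q$ for every $\mathcal L$-formula $\theta(\bar x;\bar y)$ (equivalently,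 $h_{\bar b}(\mathrm{tp}(\sigma(\bar n)/\mathfrak C))=\mathrm{tp}(\sigma^{-1}(\bar b)/N)$ for automorphisms $\sigma$ of a bigger monster model). For $p,q\in S^{\mathrm{inv}}_{\bar n}(\mathfrak C,M)$, the type $p*q$ is defined by: $\theta(\bar x;\bar b)\in p*q$ if and only if $\theta(\bar x;\bar d)\in p$, where $\bar d$ in $\mathfrak C$ realizes $h_{\bar b}(q)|_M$. Let $\mu$ be a Keisler measure (regular Borel probability measure) on $S_{\bar n}(\mathfrak C)$ which is $M$-definable: it is $\mathrm{Aut}(\mathfrak C/M)$-invariant and for each $\mathcal L$-formula $\theta(\bar x;\bar y)$ with $\bar y$ finite the function $F_\mu^\theta\colon S_{\bar y}(M)\to[0,1]$, $F^\theta_\mu(\mathrm{tp}(\bar d/M))=\mu(\theta(\bar x;\bar d))$, is continuous. Assume $\mathrm{supp}(\mu)\subseteq S^{\mathrm{inv}}_{\bar n}(\mathfrak C,M)$ and that $\mu$ is idempotent, $\mu*\mu=\mu$, where $$(\mu*\nu)(\theta(\bar x;\bar b))=\int_{S_{\bar n}(\mathfrak C)}F_\mu^\theta\big(h_{\bar b}(q)|_M\big)\,d\nu(q).$$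 Let $\pi(\bar x';\bar y')$ be a partial type over $\emptyset$ with $\pi(\bar x';\bar y')\vdash\bar x'\equiv_\emptyset\bar y'$ such that the left stabilizer of $\mu$ is given by $\pi$, that is, $$\{\sigma\in\mathrm{Aut}(\mathfrak C):\sigma\cdot\mu=\mu\}=\{\sigma\in\mathrm{Aut}(\mathfrak C):\ \models\pi(\sigma(\bar m);\bar m)\},$$ where $(\sigma\cdot\mu)(\theta(\bar x;\bar b))=\mu(\theta(\bar x;\sigma^{-1}(\bar b)))$. If $\mu$ is support-transitive, i.e. $\mathrm{supp}(\mu)\subseteq[\pi(\bar x';\bar m)]=\{q\in S_{\bar n}(\mathfrak C):\pi(\bar x';\bar m)\subseteq q\}$, then $(\mathrm{supp}(\mu),*)$ is a left-simple semigroup: $\mathrm{supp}(\mu)$ is closed under $*$, the operation $*$ is associative on it, and it has no proper left ideal. -/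

import Mathlib

open FirstOrder FirstOrder.Language MeasureTheory Cardinal

universe u v w z

noncomputable section

namespace StarProduct

section Types

variable (L : FirstOrder.Language.{u, v}) {C : Type w} [L.Structure C]

/-- `S_γ(A)`: complete types in variables indexed by `γ` over a set `A` of parameters of `C`. -/
abbrev TypesOver (A : Set C) (γ : Type z) : Type _ :=
  (L[[A]].completeTheory C).CompleteType γ

/-- `tp(d/A)`. -/
def tpOver [Nonempty C] (A : Set C) {γ : Type z} (d : γ → C) : TypesOver L A γ :=
  (L[[A]].completeTheory C).typeOf d

/-- `tp(n/∅)`. -/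
def tpEmpty [Nonempty C] {ι : Type z} (n : ι → C) : (L.completeTheory C).CompleteType ι :=
  (L.completeTheory C).typeOf n

variable (C) in
/-- `C` is a monster model with respect to the infinite cardinal `κ`: it is `κ`-saturated and
strongly `κ`-homogeneous. Sets of cardinality less than `κ` are small. -/
structure IsMonster [Nonempty C] (κ : Cardinal.{max u v w}) : Prop where
  aleph0_le : ℵ₀ ≤ κ
  card_lt : Cardinal.lift.{w} L.card < κ
  saturated : ∀ A : Set C, Cardinal.lift.{max u v} #A < κ →
    ∀ (k : ℕ) (p : TypesOver L A (Fin k)), ∃ d : Fin k → C, tpOver L A d = p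
  homogeneous : ∀ (A : Set C) (f : A → C), Cardinal.lift.{max u v} #A < κ →
    (∀ φ : L.Formula A, φ.Realize (fun a => (a : C)) ↔ φ.Realize f) →
    ∃ σ : C ≃[L] C, ∀ a : A, σ a = f a

variable {L}

/-- For an `L`-formula `θ(x; y)` and `b` in `C`, the formula `θ(x; b)` over `C`, in the form in
which it can be an element of a complete type over `C` in the variables `x`
(the variables `x` are turned into constant symbols). -/
def inst {ι : Type z} {γ : Type*} (θ : L.Formula (ι ⊕ γ)) (b : γ → C) : L[[C]][[ι]].Sentence :=
  Formula.equivSentence (BoundedFormula.constantsVarsEquiv.symm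
    (θ.relabel (Sum.elim Sum.inr (Sum.inl ∘ b)) : L.Formula (C ⊕ ι)))

variable (L) in
/-- `S_n(C)`: the global types, i.e. complete types over `C`, which extend `tp(n/∅)`. -/
def GlobalTypes [Nonempty C] {ι : Type z} (n : ι → C) : Type _ :=
  {p : (L.elementaryDiagram C).CompleteType ι //
    ∀ φ ∈ tpEmpty L n, ((L.lhomWithConstants C).addConstants ι).onSentence φ ∈ p}

end Types

section Global

/-- The index of an occurrence of an element in the tuple `n`. -/
def index {C : Type w} {ι : Type z} (n : ι → C) : Set.range n → ι := fun a => a.2.choose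

theorem index_spec {C : Type w} {ι : Type z} (n : ι → C) (a : Set.range n) : n (index n a) = a := a.2.choose_spec

variable {L : FirstOrder.Language.{u, v}} {C : Type w} [L.Structure C] [Nonempty C]
  {ι : Type z} {n : ι → C}

/-- The logic topology on `S_n(C)`. -/
instance : TopologicalSpace (GlobalTypes L n) :=
  inferInstanceAs (TopologicalSpace (Subtype _))

instance : MeasurableSpace (GlobalTypes L n) := borel _

instance : BorelSpace (GlobalTypes L n) := ⟨rfl⟩

/-- The clopen set `[θ(x; b)]` of all `q ∈ S_n(C)` containing `θ(x; b)`. -/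
def basicSet {γ : Type*} (n : ι → C) (θ : L.Formula (ι ⊕ γ)) (b : γ → C) :
    Set (GlobalTypes L n) :=
  {q | inst θ b ∈ q.1}

/-- A complete type pulls back along a language map to a complete type. -/
def pullback {L₁ L₂ : FirstOrder.Language} {T₁ : L₁.Theory} {T₂ : L₂.Theory} {α β : Type*}
    (g : L₁[[α]] →ᴸ L₂[[β]]) (q : T₂.CompleteType β)
    (h : ∀ φ ∈ T₁, g.onSentence ((L₁.lhomWithConstants α).onSentence φ) ∈ q) :
    T₁.CompleteType α where
  toTheory := {φ | g.onSentence φ ∈ q}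
  subset' := by
    rintro _ ⟨φ, hφ, rfl⟩
    exact h φ hφ
  isMaximal' := by
    refine ⟨Theory.isSatisfiable_of_isSatisfiable_onTheory g (q.isMaximal.1.mono ?_), fun φ => ?_⟩
    · rintro _ ⟨φ, hφ, rfl⟩
      exact hφ
    · exact q.mem_or_not_mem (g.onSentence φ)

/-- The translation which replaces `θ(n; y)` by `θ(x; b)`. -/
def hMap (n : ι → C) {γ : Type*} (b : γ → C) : L[[Set.range n]][[γ]] →ᴸ L[[C]][[ι]] :=
  LHom.sumElim
    (((L.lhomWithConstants C).addConstants ι).comp (L.lhomWithConstantsMap (index n)))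
    ((L[[C]].lhomWithConstants ι).comp (LHom.sumInr.comp (LHom.constantsOnMap b)))

theorem hMap_mem (q : GlobalTypes L n) {γ : Type*} (b : γ → C)
    (φ : L[[Set.range n]].Sentence) (hφ : φ ∈ L[[Set.range n]].completeTheory C) :
    (hMap n b).onSentence ((L[[Set.range n]].lhomWithConstants γ).onSentence φ) ∈ q.1 := by
  have key : (L.lhomWithConstantsMap (index n)).onSentence φ ∈ tpEmpty L n := by
    let _ : (constantsOn ι).Structure C := constantsOn.structure n
    have _ : (LHom.constantsOnMap (index n)).IsExpansionOn C :=
      constantsOnMap_isExpansionOn (funext (index_spec n))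
    have _ : (L.lhomWithConstantsMap (index n)).IsExpansionOn C := LHom.sumMap_isExpansionOn _ _ _
    exact (LHom.realize_onSentence C _ φ).2 hφ
  have h := q.2 _ key
  have e : (hMap n b).comp (L[[Set.range n]].lhomWithConstants γ) =
      ((L.lhomWithConstants C).addConstants ι).comp (L.lhomWithConstantsMap (index n)) :=
    LHom.sumElim_comp_inl _ _
  simp only [LHom.onSentence, LHom.onFormula] at h ⊢
  rw [← Function.comp_apply (f := (hMap n b).onBoundedFormula), ← LHom.comp_onBoundedFormula, e,
    LHom.comp_onBoundedFormula]
  exact h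

/-- The map `h_b : S_n(C) → S_y(N)`, where `n` enumerates `N`: it takes `tp(σ(n)/C)`, for an
automorphism `σ` of a bigger monster model, to `tp(σ⁻¹(b)/N)`. That is, `θ(n; y) ∈ h_b(q)` if and
only if `θ(x; b) ∈ q`. -/
def hType {γ : Type*} (b : γ → C) (q : GlobalTypes L n) : TypesOver L (Set.range n) γ :=
  pullback (hMap n b) q.1 (hMap_mem q b)

theorem restrict_mem {A B : Set C} (hAB : A ⊆ B) {γ : Type*} (r : TypesOver L B γ)
    (φ : L[[A]].Sentence) (hφ : φ ∈ L[[A]].completeTheory C) :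
    ((L.lhomWithConstantsMap (Set.inclusion hAB)).addConstants γ).onSentence
      ((L[[A]].lhomWithConstants γ).onSentence φ) ∈ r := by
  have h : (L[[B]].lhomWithConstants γ).onSentence
      ((L.lhomWithConstantsMap (Set.inclusion hAB)).onSentence φ) ∈ r :=
    r.subset ⟨_, (LHom.realize_onSentence C _ φ).2 hφ, rfl⟩
  have e : ((L.lhomWithConstantsMap (Set.inclusion hAB)).addConstants γ).comp
      (L[[A]].lhomWithConstants γ) =
      (L[[B]].lhomWithConstants γ).comp (L.lhomWithConstantsMap (Set.inclusion hAB)) :=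
    LHom.sumMap_comp_inl _ _
  simp only [LHom.onSentence, LHom.onFormula] at h ⊢
  rw [← Function.comp_apply (f := LHom.onBoundedFormula _), ← LHom.comp_onBoundedFormula, e,
    LHom.comp_onBoundedFormula]
  exact h

/-- The restriction map `S_y(B) → S_y(A)` for `A ⊆ B`. -/
def restrict {A B : Set C} (hAB : A ⊆ B) {γ : Type*} (r : TypesOver L B γ) : TypesOver L A γ :=
  pullback ((L.lhomWithConstantsMap (Set.inclusion hAB)).addConstants γ) r (restrict_mem hAB r)

/-- `(h_b(q))|_M ∈ S_y(M)`, where `M` is enumerated by the subtuple `n|_I` of `n`. -/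
def hTypeRes (I : Set ι) {γ : Type*} (b : γ → C) (q : GlobalTypes L n) :
    TypesOver L (n '' I) γ :=
  restrict (Set.image_subset_range n I) (hType b q)

/-- `Aut(C/A)`: automorphisms of `C` fixing `A` pointwise. -/
def autOver (L : FirstOrder.Language.{u, v}) [L.Structure C] (A : Set C) : Set (C ≃[L] C) :=
  {σ | ∀ a ∈ A, σ a = a}

/-- `S_n^inv(C, M)`: the types in `S_n(C)` which are invariant under `Aut(C/M)`, where `M` is
enumerated by `n|_I`. -/
def invTypes (L : FirstOrder.Language.{u, v}) [L.Structure C] (n : ι → C) (I : Set ι) :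
    Set (GlobalTypes L n) :=
  {p | ∀ σ ∈ autOver L (n '' I), ∀ (k : ℕ) (θ : L.Formula (ι ⊕ Fin k)) (b : Fin k → C),
    inst θ b ∈ p.1 ↔ inst θ (σ ∘ b) ∈ p.1}

/-- `r = p ∗ q`. Here `θ(x; b) ∈ p ∗ q` if and only if `θ(x; y) ∈ p(x) ⊗ h_b(q)(y)`, i.e.
`θ(x; d) ∈ p` where `d` in `C` realizes `h_b(q)|_M`. -/
def IsStarProduct (I : Set ι) (p q r : GlobalTypes L n) : Prop :=
  ∀ (k : ℕ) (θ : L.Formula (ι ⊕ Fin k)) (b : Fin k → C),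
    inst θ b ∈ r.1 ↔ ∃ d : Fin k → C, tpOver L (n '' I) d = hTypeRes I b q ∧ inst θ d ∈ p.1

end Global

section Measures

/-! A Keisler measure concentrated on `tp(n/∅)` is identified, as usual, with a regular Borel
probability measure on the compact Hausdorff space `S_n(C)`. -/

variable {L : FirstOrder.Language.{u, v}} {C : Type w} [L.Structure C] [Nonempty C]
  {ι : Type z} {n : ι → C}

/-- `μ(θ(x; b))`. -/
def eval (μ : Measure (GlobalTypes L n)) {γ : Type*} (θ : L.Formula (ι ⊕ γ)) (b : γ → C) : ℝ :=
  μ.real (basicSet n θ b)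

open Classical in
/-- The fiber function `F_μ^θ : S_y(M) → [0, 1]`, with `F_μ^θ(r) = μ(θ(x; d))` for `d ⊨ r`
(every `r` is realized in `C`, and the choice of `d` is irrelevant for an `M`-invariant `μ`). -/
def fiber (I : Set ι) (μ : Measure (GlobalTypes L n)) {k : ℕ} (θ : L.Formula (ι ⊕ Fin k))
    (r : TypesOver L (n '' I) (Fin k)) : ℝ :=
  if h : ∃ d : Fin k → C, tpOver L (n '' I) d = r then eval μ θ h.choose else 0

/-- `μ` is definable over `M`: it is `Aut(C/M)`-invariant and its fiber functions are
continuous. -/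
structure IsDefinableOver (I : Set ι) (μ : Measure (GlobalTypes L n)) : Prop where
  invariant : ∀ σ ∈ autOver L (n '' I), ∀ (k : ℕ) (θ : L.Formula (ι ⊕ Fin k)) (b : Fin k → C),
    eval μ θ b = eval μ θ (σ ∘ b)
  continuous : ∀ (k : ℕ) (θ : L.Formula (ι ⊕ Fin k)), Continuous (fiber I μ θ)

/-- `(μ ∗ ν)(θ(x; b)) = ∫ F_μ^θ(h_b(q)|_M) dν(q)`. -/
def starEval (I : Set ι) (μ ν : Measure (GlobalTypes L n)) {k : ℕ} (θ : L.Formula (ι ⊕ Fin k))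
    (b : Fin k → C) : ℝ :=
  ∫ q, fiber I μ θ (hTypeRes I b q) ∂ν

/-- `μ ∗ μ = μ`. -/
def IsIdempotent (I : Set ι) (μ : Measure (GlobalTypes L n)) : Prop :=
  ∀ (k : ℕ) (θ : L.Formula (ι ⊕ Fin k)) (b : Fin k → C), starEval I μ μ θ b = eval μ θ b

/-- The left stabilizer of `μ` in `Aut(C)`, for the action
`(σ · μ)(θ(x; b)) = μ(θ(x; σ⁻¹(b)))`. -/
def stabL (μ : Measure (GlobalTypes L n)) : Set (C ≃[L] C) :=
  {σ | ∀ (k : ℕ) (θ : L.Formula (ι ⊕ Fin k)) (b : Fin k → C),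
    eval μ θ (σ.symm ∘ b) = eval μ θ b}

/-- For a set `π(x'; y')` of `L`-formulas and `m = n|_I`, the set `G_π` of all `σ ∈ Aut(C)` such
that `⊨ π(σ(m); m)`. -/
def relDefGroup (n : ι → C) (I : Set ι) (π : Set (L.Formula (I ⊕ I))) : Set (C ≃[L] C) :=
  {σ | ∀ φ ∈ π, φ.Realize (Sum.elim (fun i => σ (n i)) (fun i => n i))}

/-- `[π(x'; m)]`: all `q ∈ S_n(C)` containing `φ(x'; m)` for each `φ ∈ π`, where `m = n|_I`. -/
def partialTypeSet (n : ι → C) (I : Set ι) (π : Set (L.Formula (I ⊕ I))) :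
    Set (GlobalTypes L n) :=
  {q | ∀ φ ∈ π,
    inst (φ.relabel (Sum.map Subtype.val id) : L.Formula (ι ⊕ I)) (fun i => n i) ∈ q.1}

end Measures

/-- A semigroup is left simple if it has no proper left ideal. -/
def IsLeftSimple (S : Type*) [Semigroup S] : Prop :=
  ∀ J : Set S, J.Nonempty → (∀ s : S, ∀ t ∈ J, s * t ∈ J) → J = Set.univ

end StarProduct

end

noncomputable section

namespace StarProduct

/-! ### Equality of types of tuples across structures -/

section SameType

variable {L : FirstOrder.Language.{u, v}}

/-! Write `m` for `n|_I` and `τ · p` for the conjugate of `p`, which contains `θ(x; b)` iff `p`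
contains `θ(x; τ⁻¹(b))`. The key point is that if `π(x'; m) ⊆ q`, then for each finite `b` some `τ`
in the group given by `π` makes `τ⁻¹(b)` a realization of `h_b(q)|_M`
(`IsMonster.exists_relDefGroup_fin`). So for `M`-invariant `p`, `p ∗ q` agrees with `τ · p` on
formulas over `b`. By support-transitivity this applies to every `q` in the support, and such a `τ`
stabilizes `μ`, so it permutes the support.

Letting the finite parameter set `s` grow gives automorphisms `τ_s`. Since the support is closed in
a compact space, `p ∗ q = lim τ_s · p` lies in it (`IsMonster.exists_star_mem_support`). Conversely,
given `r` and `q` in the support, any cluster point `p` of `τ_s⁻¹ · r` lies in the support and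
satisfies `p ∗ q = r` (`IsMonster.exists_left_factor`). Hence `supp(μ) ∗ q = supp(μ)` for every `q`,
which is left simplicity.

Associativity is a matter of composing realizations. The bigger monster model is replaced throughout
by a model `D` carrying an elementary copy of `C` and a realization `x` of the type. -/

/-- Two tuples, possibly in different structures, satisfy the same formulas. -/
def SameType (L : FirstOrder.Language.{u, v}) {J D E : Type*} [L.Structure D] [L.Structure E]
    (a : J → D) (b : J → E) : Prop :=
  ∀ φ : L.Formula J, φ.Realize a ↔ φ.Realize b

variable {J K D E F : Type*} [L.Structure D] [L.Structure E] [L.Structure F]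

theorem SameType.symm {a : J → D} {b : J → E} (h : SameType L a b) : SameType L b a :=
  fun φ => (h φ).symm

theorem SameType.trans {a : J → D} {b : J → E} {c : J → F} (h : SameType L a b)
    (h' : SameType L b c) : SameType L a c :=
  fun φ => (h φ).trans (h' φ)

theorem SameType.comp {a : J → D} {b : J → E} (h : SameType L a b) (f : K → J) :
    SameType L (a ∘ f) (b ∘ f) := fun φ => by
  simpa only [Formula.realize_relabel] using h (φ.relabel f)

theorem SameType.eq_iff {a : J → D} {b : J → E} (h : SameType L a b) (i j : J) :
    a i = a j ↔ b i = b j := by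
  simpa [Term.equal, Formula.Realize, Term.realize] using h (Term.equal (.var i) (.var j))

theorem sameType_equiv (σ : D ≃[L] D) (a : J → D) : SameType L (σ ∘ a) a := fun φ =>
  StrongHomClass.realize_formula σ φ

/-- A formula has only finitely many free variables. This is what lets unions of chains through in
the Zorn argument below. -/
theorem sameType_of_finset {a : J → D} {b : J → E}
    (h : ∀ s : Finset J, SameType L (a ∘ Subtype.val : s → D) (b ∘ Subtype.val)) :
    SameType L a b := fun φ => by
  classical
  refine (BoundedFormula.realize_restrictFreeVar (f := id)
      (v := a ∘ Subtype.val) a fun _ => rfl).symm.trans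
    (Iff.trans ?_ (BoundedFormula.realize_restrictFreeVar (f := id)
      (v := b ∘ Subtype.val) b fun _ => rfl))
  exact h φ.freeVarFinset (BoundedFormula.restrictFreeVar φ id)

end SameType

/-! ### Complete types as types of tuples in models -/

section Sentences

variable {L : FirstOrder.Language.{u, v}}

/-- Replace two layers of constant symbols by variables. -/
def toFormula {α β : Type*} : L[[α]][[β]].Sentence ≃ L.Formula (α ⊕ β) :=
  Formula.equivSentence.symm.trans BoundedFormula.constantsVarsEquiv

theorem realize_toFormula {α β D : Type*} [L.Structure D] (c : α → D) (x : β → D)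
    (φ : L[[α]][[β]].Sentence) :
    (toFormula φ).Realize (Sum.elim c x) ↔
      @Sentence.Realize _ D (@Language.withConstantsStructure _ D
        (@Language.withConstantsStructure L D _ α (constantsOn.structure c)) _
        (constantsOn.structure x)) φ := by
  let _ := constantsOn.structure c
  rw [← Formula.realize_equivSentence_symm]
  exact BoundedFormula.realize_constantsVarsEquiv (φ := Formula.equivSentence.symm φ) (v := x)

@[simp]
theorem toFormula_inst {C : Type w} {ι : Type z} {γ : Type*} (θ : L.Formula (ι ⊕ γ))
    (b : γ → C) : toFormula (inst θ b) = θ.relabel (Sum.elim Sum.inr (Sum.inl ∘ b)) := by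
  simp only [toFormula, inst, Equiv.trans_apply, Equiv.symm_apply_apply, Equiv.apply_symm_apply]

theorem realize_toFormula_inst {C : Type w} {ι : Type z} {γ D : Type*} [L.Structure D]
    (θ : L.Formula (ι ⊕ γ)) (b : γ → C) (j : C → D) (x : ι → D) :
    (toFormula (inst θ b)).Realize (Sum.elim j x) ↔ θ.Realize (Sum.elim x (j ∘ b)) := by
  rw [toFormula_inst, Formula.realize_relabel]
  congr! 1
  ext (i | i) <;> rfl

variable {C : Type w} [L.Structure C]

/-- The constants are interpreted by an arbitrary tuple `c`, so that the inclusion of a parameter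
set and the identity of `C` (the elementary diagram) are both covered. -/
theorem exists_completeType {α : Type*} (c : α → C) {γ D : Type*} [L.Structure D] [Nonempty D]
    (e : α → D) (h : SameType L e c) (y : γ → D) :
    ∃ p : (@completeTheory L[[α]] C (@Language.withConstantsStructure L C _ α
        (constantsOn.structure c))).CompleteType γ,
      ∀ φ, φ ∈ p ↔ (toFormula φ).Realize (Sum.elim e y) := by
  let _ := constantsOn.structure c
  let _ := constantsOn.structure e
  have hm : D ⊨ L[[α]].completeTheory C := by
    refine ⟨fun φ hφ => ?_⟩
    rw [mem_completeTheory, ← Formula.realize_equivSentence_symm_con] at hφ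
    rw [← Formula.realize_equivSentence_symm_con]
    exact (h _).2 hφ
  refine ⟨(L[[α]].completeTheory C).typeOf y, fun φ => ?_⟩
  rw [Theory.CompleteType.mem_typeOf]
  exact (BoundedFormula.realize_constantsVarsEquiv (φ := Formula.equivSentence.symm φ)
    (v := y)).symm

theorem SameType.of_imp {J D E : Type*} [L.Structure D] [L.Structure E] {a : J → D} {b : J → E}
    (h : ∀ φ : L.Formula J, φ.Realize a → φ.Realize b) : SameType L a b := fun φ =>
  ⟨h φ, fun hb => by_contra fun ha =>
    (Formula.realize_not.1 (h φ.not (Formula.realize_not.2 ha))) hb⟩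

/-- Any model of the type, with its constants read off as tuples, will do; `e` preserves formulas
because the type contains the complete theory of `C` with `c` named. -/
theorem exists_realization {α : Type w} (c : α → C) {γ : Type z}
    (p : (@completeTheory L[[α]] C (@Language.withConstantsStructure L C _ α
        (constantsOn.structure c))).CompleteType γ) :
    ∃ (D : Type (max u v w z)) (_ : L.Structure D) (_ : Nonempty D) (e : α → D) (y : γ → D),
      SameType L c e ∧ ∀ φ, φ ∈ p ↔ (toFormula φ).Realize (Sum.elim e y) := by
  let _ := constantsOn.structure c
  obtain ⟨⟨D⟩⟩ := p.isMaximal.1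
  let _ := (L[[α]].lhomWithConstants γ).reduct D
  let _ := (L.lhomWithConstants α).reduct D
  have h1 : ∀ φ, φ ∈ p ↔ D ⊨ φ := fun φ =>
    (p.isMaximal.mem_iff_models φ).trans (p.isMaximal.isComplete.realize_sentence_iff φ D).symm
  refine ⟨D, inferInstance, inferInstance,
    fun a => (L.con a : D), fun a => (L[[α]].con a : D), ?_, ?_⟩
  · refine SameType.of_imp fun φ hφ => ?_
    have h2 : (L[[α]].lhomWithConstants γ).onSentence (Formula.equivSentence φ) ∈ p := by
      refine p.subset ⟨_, ?_, rfl⟩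
      rw [mem_completeTheory, Formula.realize_equivSentence]
      exact hφ
    rw [h1, LHom.realize_onSentence, Formula.realize_equivSentence] at h2
    exact h2
  · intro φ
    rw [h1, ← Formula.realize_equivSentence_symm_con]
    exact (BoundedFormula.realize_constantsVarsEquiv (φ := Formula.equivSentence.symm φ)).symm

end Sentences

end StarProduct

end

noncomputable section

namespace StarProduct

/-! ### Saturation and homogeneity for small tuples -/

section Saturation

variable {L : FirstOrder.Language.{u, v}} {C : Type w} [L.Structure C] [Nonempty C]

theorem mem_tpOver {A : Set C} {γ : Type z} {d : γ → C} {φ : L[[A]][[γ]].Sentence} :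
    φ ∈ tpOver L A d ↔ (toFormula φ).Realize (Sum.elim (Subtype.val : A → C) d) := by
  rw [tpOver, Theory.CompleteType.mem_typeOf]
  exact (BoundedFormula.realize_constantsVarsEquiv (φ := Formula.equivSentence.symm φ)
    (v := d)).symm

theorem IsMonster.exists_sameType_fin {κ : Cardinal.{max u v w}} (hC : IsMonster L C κ)
    {A : Set C} (hA : Cardinal.lift.{max u v} #A < κ) {D : Type*} [L.Structure D] [Nonempty D]
    {e : A → D} (h : SameType L e Subtype.val) {k : ℕ} (y : Fin k → D) :
    ∃ d : Fin k → C, SameType L (Sum.elim Subtype.val d : A ⊕ Fin k → C) (Sum.elim e y) := by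
  obtain ⟨p, hp⟩ := exists_completeType Subtype.val e h y
  obtain ⟨d, hd⟩ := hC.saturated A hA k p
  refine ⟨d, fun φ => ?_⟩
  have h1 := hp (toFormula.symm φ)
  rw [← hd, mem_tpOver, Equiv.apply_symm_apply] at h1
  exact h1

/-- One-point extension for Zorn. `G` is only a relation, but equality of types preserves and
reflects equality of entries, so its second projection injects into `J` and is a small parameter
set. -/
theorem IsMonster.exists_sameType_insert {κ : Cardinal.{max u v w}} (hC : IsMonster L C κ)
    {J : Type w} (hJ : Cardinal.lift.{max u v} #J < κ) {D : Type*} [L.Structure D] [Nonempty D]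
    (y : J → D) {G : Set (J × C)}
    (hG : SameType L (fun g : G => y g.1.1) (fun g : G => g.1.2)) (i : J) :
    ∃ c : C, SameType L (fun g : (insert (i, c) G : Set (J × C)) => y g.1.1)
      (fun g => g.1.2) := by
  classical
  let A : Set C := Prod.snd '' G
  have hA' : ∀ a : A, ∃ g : G, g.1.2 = a := fun ⟨_, g, hg, h⟩ => ⟨⟨g, hg⟩, h⟩
  choose s hs using hA'
  have hinj : Function.Injective (fun a : A => (s a).1.1) := fun a b hab => by
    have := (hG.eq_iff (s a) (s b)).1 (congrArg y hab)
    exact Subtype.ext (by rw [← hs, ← hs]; exact this)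
  have hA : Cardinal.lift.{max u v} #A < κ :=
    (Cardinal.lift_le.2 (Cardinal.mk_le_of_injective hinj)).trans_lt hJ
  have hs' : SameType L (fun a : A => y (s a).1.1) (Subtype.val : A → C) := by
    have := hG.comp s
    rwa [show (fun g : G => g.1.2) ∘ s = Subtype.val from funext hs] at this
  obtain ⟨d, hd⟩ := hC.exists_sameType_fin hA hs' (fun _ : Fin 1 => y i)
  refine ⟨d 0, ?_⟩
  let f : (insert (i, d 0) G : Set (J × C)) → A ⊕ Fin 1 := fun g =>
    if h : g.1 ∈ G then .inl ⟨g.1.2, g.1, h, rfl⟩ else .inr 0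
  have := (hd.comp f).symm
  convert this using 1
  · ext ⟨g, hg⟩
    by_cases h : g ∈ G
    · simpa [f, h] using (hG.eq_iff ⟨g, h⟩ (s ⟨g.2, g, h, rfl⟩)).2 (hs ⟨g.2, g, h, rfl⟩).symm
    · obtain rfl := hg.resolve_right h
      simp [f, h]
  · ext ⟨g, hg⟩
    by_cases h : g ∈ G
    · simp [f, h]
    · obtain rfl := hg.resolve_right h
      simp [f, h]

/-- A monster model realizes the type of every small tuple, extending any given partial
realization. -/
theorem IsMonster.exists_sameType {κ : Cardinal.{max u v w}} (hC : IsMonster L C κ)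
    {J : Type w} (hJ : Cardinal.lift.{max u v} #J < κ) {D : Type*} [L.Structure D] [Nonempty D]
    (y : J → D) {K : Type*} (f : K → J) (e : K → C) (he : SameType L (y ∘ f) e) :
    ∃ c : J → C, SameType L y c ∧ c ∘ f = e := by
  -- A maximal type-preserving relation extending the graph of the prescribed part is total by
  -- one-point extension, and single-valued by `SameType.eq_iff`.
  let P : Set (Set (J × C)) := {G | SameType L (fun g : G => y g.1.1) (fun g : G => g.1.2)}
  have h0 : Set.range (fun k => (f k, e k)) ∈ P := by
    choose s hs using fun g : Set.range (fun k => (f k, e k)) => g.2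
    change SameType L (fun g : Set.range (fun k => (f k, e k)) => y g.1.1) (fun g => g.1.2)
    convert he.comp s using 1
    · ext g; simp [← hs g]
    · ext g; simp [← hs g]
  obtain ⟨G, hle, hG⟩ := zorn_subset_nonempty P (fun c hc hchain hne => by
    refine ⟨⋃₀ c, ?_, fun s hs => Set.subset_sUnion_of_mem hs⟩
    refine sameType_of_finset fun t => ?_
    obtain ⟨G, hGc, hG⟩ : ∃ G ∈ c, ∀ g ∈ t, g.1 ∈ G := by
      obtain ⟨G, hGc, hG⟩ := DirectedOn.exists_mem_subset_of_finite_of_subset_sUnion hne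
        hchain.directedOn ((t.finite_toSet).image Subtype.val)
        (by rintro _ ⟨g, _, rfl⟩; exact g.2)
      exact ⟨G, hGc, fun g hg => hG ⟨g, hg, rfl⟩⟩
    exact (hc hGc).comp fun g : t => (⟨g.1.1, hG _ g.2⟩ : G)) _ h0
  have hex : ∀ i, ∃ c, (i, c) ∈ G := fun i => by
    obtain ⟨c, hc⟩ := hC.exists_sameType_insert hJ y hG.prop i
    exact ⟨c, hG.le_of_ge hc (Set.subset_insert _ _) (Set.mem_insert _ _)⟩
  choose c hc using hex
  refine ⟨c, hG.prop.comp fun i => (⟨_, hc i⟩ : G), funext fun k => ?_⟩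
  exact ((show SameType L _ _ from hG.prop).eq_iff ⟨_, hc (f k)⟩ ⟨_, hle ⟨k, rfl⟩⟩).1 rfl

/-- Small tuples of the same type are conjugate under automorphisms of a monster model. -/
theorem IsMonster.exists_equiv {κ : Cardinal.{max u v w}} (hC : IsMonster L C κ)
    {J : Type w} (hJ : Cardinal.lift.{max u v} #J < κ) {a b : J → C} (h : SameType L a b) :
    ∃ σ : C ≃[L] C, σ ∘ a = b := by
  -- Homogeneity concerns maps on sets. The chosen preimages do not matter, since `a` and `b` have
  -- the same repetitions.
  choose s hs using fun x : Set.range a => x.2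
  obtain ⟨σ, hσ⟩ := hC.homogeneous (Set.range a) (b ∘ s)
    ((Cardinal.lift_le.2 Cardinal.mk_range_le).trans_lt hJ) (by
      have := h.comp s
      rwa [show a ∘ s = Subtype.val from funext hs] at this)
  refine ⟨σ, funext fun j => ?_⟩
  exact (hσ ⟨a j, j, rfl⟩).trans ((h.eq_iff _ _).1 (hs ⟨a j, j, rfl⟩))

end Saturation

end StarProduct

end

noncomputable section

namespace StarProduct

/-! ### The space of global types -/

section GlobalTypes

variable {L : FirstOrder.Language.{u, v}} {C : Type w} [L.Structure C]
  {ι : Type z} {n : ι → C}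

theorem onSentence_mem_iff {p : (L.elementaryDiagram C).CompleteType ι} {D : Type*}
    [L.Structure D] {j : C → D} {x : ι → D}
    (hp : ∀ φ, φ ∈ p ↔ (toFormula φ).Realize (Sum.elim j x)) (φ : L[[ι]].Sentence) :
    ((L.lhomWithConstants C).addConstants ι).onSentence φ ∈ p ↔
      (Formula.equivSentence.symm φ).Realize x := by
  rw [hp, realize_toFormula, Formula.realize_equivSentence_symm]
  let _ := constantsOn.structure j
  let _ := constantsOn.structure x
  have : ((L.lhomWithConstants C).addConstants ι).IsExpansionOn D :=
    LHom.sumMap_isExpansionOn _ _ _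
  exact LHom.realize_onSentence D _ φ

variable [Nonempty C]

/-- Stands in for the bigger monster model: `x` plays the role of `σ(n)`, and `j` embeds `C`
elementarily. -/
theorem GlobalTypes.exists_model (q : GlobalTypes L n) :
    ∃ (D : Type (max u v w z)) (_ : L.Structure D) (_ : Nonempty D) (j : C → D) (x : ι → D),
      SameType L j id ∧ SameType L x n ∧
        ∀ φ, φ ∈ q.1 ↔ (toFormula φ).Realize (Sum.elim j x) := by
  obtain ⟨D, hD, hD', j, x, h, hq⟩ := exists_realization id q.1
  refine ⟨D, hD, hD', j, x, h.symm, (SameType.of_imp fun φ hφ => ?_).symm, hq⟩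
  have := q.2 (Formula.equivSentence φ) (Theory.CompleteType.formula_mem_typeOf.2 hφ)
  rwa [onSentence_mem_iff hq, Equiv.symm_apply_apply] at this

theorem GlobalTypes.exists_of_model {D : Type*} [L.Structure D] [Nonempty D] {j : C → D}
    {x : ι → D} (hj : SameType L j id) (hx : SameType L x n) :
    ∃ q : GlobalTypes L n, ∀ φ, φ ∈ q.1 ↔ (toFormula φ).Realize (Sum.elim j x) := by
  obtain ⟨p, hp⟩ := exists_completeType id j hj x
  refine ⟨⟨p, fun φ hφ => ?_⟩, hp⟩
  rw [onSentence_mem_iff hp, hx]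
  exact Theory.CompleteType.mem_typeOf.1 hφ

/-- Every sentence over `C` in the variables `ι` is an instance of a formula at a finite tuple. -/
theorem exists_inst (φ : L[[C]][[ι]].Sentence) :
    ∃ (k : ℕ) (θ : L.Formula (ι ⊕ Fin k)) (b : Fin k → C),
      ∀ q : GlobalTypes L n, inst θ b ∈ q.1 ↔ φ ∈ q.1 := by
  classical
  let ψ := toFormula φ
  -- The finitely many elements of `C` occurring in the formula become the variables `Fin k`.
  let s : Finset C := ψ.freeVarFinset.toLeft
  let f : ψ.freeVarFinset → ι ⊕ Fin s.card := fun a => match a with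
    | ⟨.inl c, h⟩ => .inr (s.equivFin ⟨c, Finset.mem_toLeft.2 h⟩)
    | ⟨.inr i, _⟩ => .inl i
  refine ⟨s.card, BoundedFormula.restrictFreeVar ψ f, fun i => (s.equivFin.symm i).1,
    fun q => ?_⟩
  obtain ⟨D, _, _, j, x, hj, hx, hq⟩ := q.exists_model
  rw [hq, hq, realize_toFormula_inst]
  refine BoundedFormula.realize_restrictFreeVar (Sum.elim j x) ?_
  rintro ⟨c | i, h⟩ <;> simp [f]

theorem GlobalTypes.ext_inst {p q : GlobalTypes L n}
    (h : ∀ (k : ℕ) (θ : L.Formula (ι ⊕ Fin k)) (b : Fin k → C), inst θ b ∈ p.1 → inst θ b ∈ q.1) :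
    p = q := by
  have key : ∀ φ, φ ∈ p.1 → φ ∈ q.1 := fun φ => by
    obtain ⟨k, θ, b, hb⟩ := exists_inst (n := n) φ
    rw [← hb, ← hb]
    exact h k θ b
  refine Subtype.ext (SetLike.ext fun φ => ⟨key φ, fun hφ => by_contra fun hn => ?_⟩)
  exact (Theory.CompleteType.not_mem_iff _ _).1
    (key _ ((Theory.CompleteType.not_mem_iff _ _).2 hn)) hφ

theorem isClopen_basicSet {γ : Type*} (θ : L.Formula (ι ⊕ γ)) (b : γ → C) :
    IsClopen (basicSet n θ b) :=
  (CompleteType.isClopen_typesWith (T := L.elementaryDiagram C) (inst θ b)).preimage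
    continuous_subtype_val

theorem exists_basicSet_subset {q : GlobalTypes L n} {U : Set (GlobalTypes L n)}
    (hU : U ∈ nhds q) : ∃ (k : ℕ) (θ : L.Formula (ι ⊕ Fin k)) (b : Fin k → C),
      q ∈ basicSet n θ b ∧ basicSet n θ b ⊆ U := by
  have hb := (CompleteType.isTopologicalBasis_range_typesWith (T := L.elementaryDiagram C)
    (α := ι)).induced (Subtype.val : GlobalTypes L n → _)
  obtain ⟨_, ⟨_, ⟨φ, rfl⟩, rfl⟩, hq, hs⟩ := hb.mem_nhds_iff.1 hU
  obtain ⟨k, θ, b, h⟩ := exists_inst (n := n) φ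
  exact ⟨k, θ, b, (h q).2 hq, fun r hr => hs ((h r).1 hr)⟩

instance : CompactSpace (GlobalTypes L n) := by
  have : {p : (L.elementaryDiagram C).CompleteType ι |
      ∀ φ ∈ tpEmpty L n, ((L.lhomWithConstants C).addConstants ι).onSentence φ ∈ p} =
      ⋂ φ ∈ tpEmpty L n, (L.elementaryDiagram C).typesWith
        (((L.lhomWithConstants C).addConstants ι).onSentence φ) := by
    ext p; simp
  refine isCompact_iff_compactSpace.1 (IsClosed.isCompact ?_)
  have h := isClosed_biInter (s := {φ | φ ∈ tpEmpty L n}) fun φ _ =>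
    CompleteType.isClosed_typesWith (T := L.elementaryDiagram C)
      (((L.lhomWithConstants C).addConstants ι).onSentence φ)
  exact (congrArg IsClosed this).mpr h

/-- Conjugating a global type by an automorphism. -/
theorem exists_conj (σ : C ≃[L] C) (p : GlobalTypes L n) :
    ∃ q : GlobalTypes L n, ∀ (k : ℕ) (θ : L.Formula (ι ⊕ Fin k)) (b : Fin k → C),
      inst θ b ∈ q.1 ↔ inst θ (σ.symm ∘ b) ∈ p.1 := by
  obtain ⟨D, _, _, j, x, hj, hx, hp⟩ := p.exists_model
  -- Keep `x` and precompose the copy of `C` with `σ⁻¹`.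
  obtain ⟨q, hq⟩ := GlobalTypes.exists_of_model (j := j ∘ σ.symm) (x := x)
    ((hj.comp σ.symm).trans (sameType_equiv σ.symm id)) hx
  exact ⟨q, fun k θ b => by rw [hq, hp, realize_toFormula_inst, realize_toFormula_inst]; rfl⟩

end GlobalTypes

/-! ### Realizations of `h_b(q)|_M` without constant symbols -/

section Restriction

variable {L : FirstOrder.Language.{u, v}} {C : Type w} [L.Structure C] [Nonempty C]
  {ι : Type z} {n : ι → C}

/-- `d` realizes `h_b(q)|_M`, expressed with `L`-formulas in the variables of `n|_I`. -/
def RealizesRes (I : Set ι) {γ : Type*} (b : γ → C) (q : GlobalTypes L n) (d : γ → C) : Prop :=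
  ∀ ψ : L.Formula (I ⊕ γ), ψ.Realize (Sum.elim (fun i => n i) d) ↔
    inst (ψ.relabel (Sum.map Subtype.val id) : L.Formula (ι ⊕ γ)) b ∈ q.1

/-- The counterpart of `h_b(tp(σ(n)/C)) = tp(σ⁻¹(b)/N)`: the pair `(m, d)` looks like `(x|_I, b)`.
-/
theorem realizesRes_iff_sameType {I : Set ι} {γ : Type*} {b d : γ → C} {q : GlobalTypes L n}
    {D : Type*} [L.Structure D] {j : C → D} {x : ι → D}
    (hq : ∀ φ, φ ∈ q.1 ↔ (toFormula φ).Realize (Sum.elim j x)) :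
    RealizesRes I b q d ↔
      SameType L (Sum.elim (fun i : I => n i) d) (Sum.elim (fun i : I => x i) (j ∘ b)) := by
  refine forall_congr' fun ψ => ?_
  rw [hq, realize_toFormula_inst, Formula.realize_relabel, Sum.elim_comp_map]
  rfl

theorem isExpansionOn_comp {L₁ L₂ L₃ : FirstOrder.Language} {D : Type*} [L₁.Structure D]
    [L₂.Structure D] [L₃.Structure D] (g : L₂ →ᴸ L₃) (f : L₁ →ᴸ L₂) [g.IsExpansionOn D]
    [f.IsExpansionOn D] : (g.comp f).IsExpansionOn D :=
  ⟨fun F xs => (g.map_onFunction (f.onFunction F) xs).trans (f.map_onFunction F xs),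
    fun R xs => (g.map_onRelation (f.onRelation R) xs).trans (f.map_onRelation R xs)⟩

/-- With the constants suitably interpreted in `D`, each layer of the translation is an expansion of
structures, so it preserves truth. -/
theorem mem_hTypeRes {I : Set ι} {γ : Type*} {b : γ → C} {q : GlobalTypes L n}
    {D : Type*} [L.Structure D] {j : C → D} {x : ι → D}
    (hq : ∀ φ, φ ∈ q.1 ↔ (toFormula φ).Realize (Sum.elim j x))
    (φ : L[[n '' I]][[γ]].Sentence) :
    φ ∈ hTypeRes I b q ↔ (toFormula φ).Realize
      (Sum.elim (fun a => x (index n (Set.inclusion (Set.image_subset_range n I) a))) (j ∘ b)) := by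
  change (hMap n b).onSentence (((L.lhomWithConstantsMap (Set.inclusion
    (Set.image_subset_range n I))).addConstants γ).onSentence φ) ∈ q.1 ↔ _
  rw [hq, realize_toFormula, realize_toFormula]
  let _ := constantsOn.structure j
  let _ := constantsOn.structure x
  let _ : (constantsOn (Set.range n)).Structure D := constantsOn.structure (x ∘ index n)
  let _ : (constantsOn γ).Structure D := constantsOn.structure (j ∘ b)
  let _ : (constantsOn (n '' I)).Structure D := constantsOn.structure
    (fun a => x (index n (Set.inclusion (Set.image_subset_range n I) a)))
  let S₁ : L[[C]][[ι]].Structure D := inferInstance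
  let S₂ : L[[Set.range n]][[γ]].Structure D := inferInstance
  let S₃ : L[[n '' I]][[γ]].Structure D := inferInstance
  have h₁ : (L.lhomWithConstantsMap (index n)).IsExpansionOn D :=
    have := constantsOnMap_isExpansionOn (f := index n) (fα := x ∘ index n) (fβ := x) rfl
    LHom.sumMap_isExpansionOn _ _ _
  have : ((L.lhomWithConstants C).addConstants ι).IsExpansionOn D :=
    LHom.sumMap_isExpansionOn _ _ _
  have : (LHom.constantsOnMap b).IsExpansionOn D :=
    constantsOnMap_isExpansionOn (f := b) (fα := j ∘ b) (fβ := j) rfl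
  have h₂ : (((L.lhomWithConstants C).addConstants ι).comp
      (L.lhomWithConstantsMap (index n))).IsExpansionOn D := isExpansionOn_comp _ _
  have h₃ : ((L[[C]].lhomWithConstants ι).comp
      (LHom.sumInr.comp (LHom.constantsOnMap b))).IsExpansionOn D :=
    ⟨fun F xs => (LHom.constantsOnMap b).map_onFunction F xs, fun R => R.elim⟩
  have : (hMap (L := L) n b).IsExpansionOn D := LHom.sumElim_isExpansionOn _ _ _
  have : (L.lhomWithConstantsMap (Set.inclusion
      (Set.image_subset_range n I))).IsExpansionOn D :=
    have := constantsOnMap_isExpansionOn (f := Set.inclusion (Set.image_subset_range n I))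
      (fα := fun a => x (index n (Set.inclusion (Set.image_subset_range n I) a)))
      (fβ := x ∘ index n) rfl
    LHom.sumMap_isExpansionOn _ _ _
  have : ((L.lhomWithConstantsMap (Set.inclusion
      (Set.image_subset_range n I))).addConstants γ).IsExpansionOn D :=
    LHom.sumMap_isExpansionOn _ _ _
  exact (LHom.realize_onSentence D (hMap n b) _).trans (LHom.realize_onSentence D _ φ)

theorem tpOver_eq_hTypeRes_iff {I : Set ι} {γ : Type*} {b d : γ → C} {q : GlobalTypes L n} :
    tpOver L (n '' I) d = hTypeRes I b q ↔ RealizesRes I b q d := by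
  obtain ⟨D, _, _, j, x, hj, hx, hq⟩ := q.exists_model
  rw [realizesRes_iff_sameType hq]
  -- `index` may choose another occurrence of `n i`, but `x` repeats entries exactly where `n` does.
  have hfac : ∀ i : I, x i = x (index n (Set.inclusion (Set.image_subset_range n I)
      ⟨n i, i, i.2, rfl⟩)) := fun i => (hx.eq_iff _ _).2
      (index_spec n ⟨n i, i, rfl⟩).symm
  choose s hs using fun a : n '' I => a.2
  have h1 : (tpOver L (n '' I) d = hTypeRes I b q) ↔ SameType L (Sum.elim Subtype.val d)
      (Sum.elim (fun a => x (index n (Set.inclusion (Set.image_subset_range n I) a)))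
        (j ∘ b)) := by
    rw [SetLike.ext_iff]
    simp only [mem_tpOver, mem_hTypeRes hq]
    exact ⟨fun h φ => by simpa using h (toFormula.symm φ), fun h φ => h _⟩
  rw [h1]
  constructor <;> intro h
  · convert h.comp (Sum.map (fun i : I => (⟨n i, i, i.2, rfl⟩ : n '' I)) id) using 1
    · ext (i | i) <;> rfl
    · ext (i | i)
      · exact hfac i
      · rfl
  · convert h.comp (Sum.map (fun a : n '' I => (⟨s a, (hs a).1⟩ : I)) id) using 1
    · ext (i | i)
      · exact (hs i).2.symm
      · rfl
    · ext (i | i)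
      · exact (hx.eq_iff _ _).2 ((index_spec n _).trans (hs i).2.symm)
      · rfl

end Restriction

end StarProduct

end

noncomputable section

namespace StarProduct

variable {L : FirstOrder.Language.{u, v}} {C : Type w} [L.Structure C] [Nonempty C]
  {ι : Type z} {n : ι → C} {I : Set ι} {κ : Cardinal.{max u v w}}

/-! ### Realizing restrictions through the group given by `π` -/

section Realizations

theorem RealizesRes.comp {γ δ : Type*} {b d : γ → C} {q : GlobalTypes L n}
    (h : RealizesRes I b q d) (f : δ → γ) : RealizesRes I (b ∘ f) q (d ∘ f) := by
  obtain ⟨D, _, _, j, x, hj, hx, hq⟩ := q.exists_model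
  rw [realizesRes_iff_sameType hq] at h ⊢
  have := h.comp (Sum.map id f)
  rwa [Sum.elim_comp_map, Sum.elim_comp_map] at this

theorem RealizesRes.sameType {γ : Type*} {b d d' : γ → C} {q : GlobalTypes L n}
    (h : RealizesRes I b q d) (h' : RealizesRes I b q d') :
    SameType L (Sum.elim (fun i : I => n i) d) (Sum.elim (fun i : I => n i) d') :=
  fun ψ => (h ψ).trans (h' ψ).symm

theorem IsMonster.exists_realizesRes (hC : IsMonster L C κ)
    (hI : Cardinal.lift.{max u v} #(n '' I) < κ) {k : ℕ} (b : Fin k → C)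
    (q : GlobalTypes L n) : ∃ d, RealizesRes I b q d := by
  obtain ⟨d, hd⟩ := hC.saturated _ hI k (hTypeRes I b q)
  exact ⟨d, tpOver_eq_hTypeRes_iff.1 hd⟩

theorem IsMonster.small_sum_fin (hC : IsMonster L C κ) {A : Type w}
    (hA : Cardinal.lift.{max u v} #A < κ) (k : ℕ) :
    Cardinal.lift.{max u v} #(A ⊕ ULift.{w} (Fin k)) < κ := by
  rw [mk_sum, lift_id, lift_id, lift_add]
  refine add_lt_of_lt hC.aleph0_le hA (lt_of_lt_of_le ?_ hC.aleph0_le)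
  rw [lift_lt_aleph0]
  exact mk_lt_aleph0

/-- Finite tuples of the same type over `M` are conjugate over `M`. -/
theorem IsMonster.exists_autOver (hC : IsMonster L C κ)
    (hI : Cardinal.lift.{max u v} #(n '' I) < κ) {k : ℕ} {d d' : Fin k → C}
    (h : SameType L (Sum.elim (fun i : I => n i) d) (Sum.elim (fun i : I => n i) d')) :
    ∃ σ ∈ autOver L (n '' I), σ ∘ d = d' := by
  choose s hs using fun a : n '' I => a.2
  have h1 := h.comp (Sum.map (fun a : n '' I => (⟨s a, (hs a).1⟩ : I)) (ULift.down.{w}))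
  obtain ⟨σ, hσ⟩ := hC.exists_equiv (hC.small_sum_fin hI k) h1
  refine ⟨σ, fun a ha => ?_, funext fun i => congrFun hσ (.inr ⟨i⟩)⟩
  have := congrFun hσ (.inl ⟨a, ha⟩)
  simpa [(hs ⟨a, ha⟩).2] using this

theorem IsMonster.inst_mem_iff_of_mem_invTypes (hC : IsMonster L C κ)
    (hI : Cardinal.lift.{max u v} #(n '' I) < κ) {p : GlobalTypes L n}
    (hp : p ∈ invTypes L n I) {k : ℕ} {d d' : Fin k → C}
    (h : SameType L (Sum.elim (fun i : I => n i) d) (Sum.elim (fun i : I => n i) d'))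
    (θ : L.Formula (ι ⊕ Fin k)) : inst θ d ∈ p.1 ↔ inst θ d' ∈ p.1 := by
  obtain ⟨σ, hσ, rfl⟩ := hC.exists_autOver hI h
  exact hp σ hσ k θ d

/-- If `q` contains `π(x'; m)`, then every finite `b` is the image, under an automorphism in the
group defined by `π`, of a realization of `h_b(q)|_M`. -/
theorem IsMonster.exists_relDefGroup_fin (hC : IsMonster L C κ)
    (hI : Cardinal.lift.{max u v} #(n '' I) < κ) {π : Set (L.Formula (I ⊕ I))}
    {q : GlobalTypes L n} (hq : q ∈ partialTypeSet n I π) {k : ℕ} (b : Fin k → C) :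
    ∃ τ ∈ relDefGroup n I π, RealizesRes I b q (τ.symm ∘ b) := by
  obtain ⟨d, hd⟩ := hC.exists_realizesRes hI b q
  obtain ⟨D, _, _, j, x, hj, hx, hmem⟩ := q.exists_model
  have hd' := (realizesRes_iff_sameType hmem).1 hd
  choose s hs using fun a : n '' I => a.2
  have hxs : ∀ i : I, x (s ⟨n i, i, i.2, rfl⟩) = x i := fun i =>
    (hx.eq_iff _ _).2 (hs ⟨n i, i, i.2, rfl⟩).2
  let e : (n '' I) ⊕ ULift.{w} (Fin k) → C := Sum.elim Subtype.val (b ∘ ULift.down)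
  have hJ : Cardinal.lift.{max u v} #((n '' I) ⊕ ((n '' I) ⊕ ULift.{w} (Fin k))) < κ := by
    rw [mk_sum, lift_id, lift_id, lift_add]
    exact add_lt_of_lt hC.aleph0_le hI (hC.small_sum_fin hI k)
  -- Pull `x|_I` down into `C` over `m` and `b`: the left block of `c` is a copy of `x|_I` and the
  -- right block is fixed to be `m, b`.
  obtain ⟨c, hyc, hce⟩ := hC.exists_sameType hJ
    (Sum.elim (fun a : n '' I => x (s a)) (j ∘ e)) Sum.inr e (hj.comp e)
  -- `(m, d) ≡ (x|_I, b) ≡ (c, b)`, so homogeneity yields `τ` with `τ(m) = c` and `τ(d) = b`.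
  have h1 : SameType L (Sum.elim Subtype.val (d ∘ ULift.down) : (n '' I) ⊕ ULift.{w} (Fin k) → C)
      (Sum.elim (c ∘ Sum.inl) (b ∘ ULift.down)) := by
    have h2 := hd'.comp (Sum.map (fun a : n '' I => (⟨s a, (hs a).1⟩ : I)) (ULift.down.{w}))
    have h3 := hyc.comp (Sum.map id Sum.inr :
      (n '' I) ⊕ ULift.{w} (Fin k) → (n '' I) ⊕ ((n '' I) ⊕ ULift.{w} (Fin k)))
    rw [Sum.elim_comp_map, Sum.elim_comp_map] at h2
    rw [Sum.elim_comp_map] at h3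
    have h4 : Sum.elim (c ∘ Sum.inl) (b ∘ ULift.down.{w}) = c ∘ Sum.map id Sum.inr := by
      ext (a | i)
      · rfl
      · exact (congrFun hce (.inr i)).symm
    have h5 : Sum.elim Subtype.val (d ∘ ULift.down.{w}) = Sum.elim ((fun i : I => n i) ∘
        fun a : n '' I => (⟨s a, (hs a).1⟩ : I)) (d ∘ ULift.down.{w}) := by
      ext (a | i)
      · exact (hs a).2.symm
      · rfl
    rw [h4, h5]
    exact h2.trans h3
  obtain ⟨τ, hτ⟩ := hC.exists_equiv (hC.small_sum_fin hI k) h1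
  have hτd : τ ∘ d = b := funext fun i => congrFun hτ (.inr ⟨i⟩)
  refine ⟨τ, fun φ hφ => ?_, ?_⟩
  -- `π(x|_I; m)` holds in `D` and `(c, m) ≡ (x|_I, m)`, hence `π(τ(m); m)`.
  · have h4 := (hq φ hφ)
    rw [hmem, realize_toFormula_inst, Formula.realize_relabel, Sum.elim_comp_map] at h4
    have h5 := hyc.comp (Sum.map (fun i : I => (⟨n i, i, i.2, rfl⟩ : n '' I))
      (fun i : I => (.inl ⟨n i, i, i.2, rfl⟩ : (n '' I) ⊕ ULift.{w} (Fin k)))) φ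
    convert h5.1 (by
      convert h4 using 1
      ext (i | i)
      · exact hxs i
      · rfl) using 1
    ext (i | i)
    · exact congrFun hτ (.inl ⟨n i, i, i.2, rfl⟩)
    · exact (congrFun hce (.inl ⟨n i, i, i.2, rfl⟩)).symm
  · convert hd
    rw [← hτd]
    ext i
    simp

/-- Applying the previous result to an enumeration of `s` gives one `τ` serving all tuples from `s`;
this produces the net indexed by finite sets. -/
theorem IsMonster.exists_relDefGroup (hC : IsMonster L C κ)
    (hI : Cardinal.lift.{max u v} #(n '' I) < κ) {π : Set (L.Formula (I ⊕ I))}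
    {q : GlobalTypes L n} (hq : q ∈ partialTypeSet n I π) (s : Finset C) :
    ∃ τ ∈ relDefGroup n I π, ∀ (k : ℕ) (b : Fin k → C), (∀ i, b i ∈ s) →
      RealizesRes I b q (τ.symm ∘ b) := by
  obtain ⟨τ, hτ, h⟩ := hC.exists_relDefGroup_fin hI hq (fun i => (s.equivFin.symm i : C))
  refine ⟨τ, hτ, fun k b hb => ?_⟩
  convert h.comp (fun i => s.equivFin ⟨b i, hb i⟩) using 1 <;> ext i <;> simp

end Realizations

/-! ### Limits of conjugates inside the support -/

section Support

variable {μ : Measure (GlobalTypes L n)}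

theorem inst_not_mem_iff {γ : Type*} {θ : L.Formula (ι ⊕ γ)} {b : γ → C} {q : GlobalTypes L n} :
    inst θ.not b ∈ q.1 ↔ inst θ b ∉ q.1 := by
  obtain ⟨D, _, _, j, x, hj, hx, hq⟩ := q.exists_model
  simp only [hq, realize_toFormula_inst, Formula.realize_not]

/-- Take a cluster point in the compact support. If it omitted `θ(x; b)`, the net would frequently
enter the clopen complement. -/
theorem exists_limit_mem_support (p : Finset C → GlobalTypes L n) (hp : ∀ s, p s ∈ μ.support) :
    ∃ r ∈ μ.support, ∀ (k : ℕ) (θ : L.Formula (ι ⊕ Fin k)) (b : Fin k → C),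
      (∀ᶠ s in Filter.atTop, inst θ b ∈ (p s).1) → inst θ b ∈ r.1 := by
  obtain ⟨r, hr, hc⟩ := (Measure.isClosed_support (μ := μ)).isCompact.exists_mapClusterPt
    (f := Filter.atTop) (u := p)
    (Filter.le_principal_iff.2 (Filter.mem_map.2 (Filter.Eventually.of_forall hp)))
  refine ⟨r, hr, fun k θ b h => ?_⟩
  by_contra hn
  obtain ⟨s, hs, hs'⟩ := ((hc.frequently
    ((isClopen_basicSet θ b).compl.isOpen.mem_nhds hn)).and_eventually h).exists
  exact hs hs'

variable [IsFiniteMeasure μ]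

/-- Each basic neighbourhood of `q` has the same measure as a corresponding neighbourhood of `p`,
which is positive. -/
theorem mem_support_of_eval_comp {g : C → C}
    (hg : ∀ (k : ℕ) (θ : L.Formula (ι ⊕ Fin k)) (b : Fin k → C),
      eval μ θ (g ∘ b) = eval μ θ b) {p q : GlobalTypes L n} (hp : p ∈ μ.support)
    (hq : ∀ (k : ℕ) (θ : L.Formula (ι ⊕ Fin k)) (b : Fin k → C),
      inst θ b ∈ q.1 ↔ inst θ (g ∘ b) ∈ p.1) : q ∈ μ.support := by
  rw [Measure.mem_support_iff_forall] at hp ⊢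
  intro U hU
  obtain ⟨k, θ, b, hb, hs⟩ := exists_basicSet_subset hU
  refine lt_of_lt_of_le ?_ (measure_mono hs)
  have h1 : 0 < eval μ θ (g ∘ b) := ENNReal.toReal_pos
    (hp _ ((isClopen_basicSet θ (g ∘ b)).isOpen.mem_nhds ((hq k θ b).1 hb))).ne'
    (measure_ne_top _ _)
  rw [hg] at h1
  exact (ENNReal.toReal_pos_iff.1 h1).1

variable {π : Set (L.Formula (I ⊕ I))}

/-- The product is the limit of `τ_s · p`: once `s` contains `b`, both `τ_s⁻¹(b)` and `d` realize
`h_b(q)|_M`, and the `M`-invariant `p` cannot tell them apart. -/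
theorem IsMonster.exists_star_mem_support (hC : IsMonster L C κ)
    (hI : Cardinal.lift.{max u v} #(n '' I) < κ) (hsupp : μ.support ⊆ invTypes L n I)
    (hstab : stabL μ = relDefGroup n I π) (htrans : μ.support ⊆ partialTypeSet n I π)
    {p q : GlobalTypes L n} (hp : p ∈ μ.support) (hq : q ∈ μ.support) :
    ∃ r ∈ μ.support, ∀ (k : ℕ) (θ : L.Formula (ι ⊕ Fin k)) (b d : Fin k → C),
      RealizesRes I b q d → (inst θ b ∈ r.1 ↔ inst θ d ∈ p.1) := by
  choose τ hτ hres using hC.exists_relDefGroup hI (htrans hq)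
  choose f hf using fun s => exists_conj (τ s) p
  obtain ⟨r, hr, h⟩ := exists_limit_mem_support (μ := μ) f fun s =>
    mem_support_of_eval_comp (hstab ▸ hτ s : τ s ∈ stabL μ) hp (hf s)
  have key : ∀ (k : ℕ) (θ : L.Formula (ι ⊕ Fin k)) (b d : Fin k → C),
      RealizesRes I b q d → inst θ d ∈ p.1 → inst θ b ∈ r.1 := fun k θ b d hd hθ => by
    classical
    refine h k θ b ?_
    filter_upwards [Filter.eventually_ge_atTop (Finset.univ.image b)] with s hs
    rw [hf]
    refine (hC.inst_mem_iff_of_mem_invTypes hI (hsupp hp) (hd.sameType (hres s k b fun i =>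
      hs (Finset.mem_image_of_mem b (Finset.mem_univ i)))) θ).1 hθ
  -- The converse is the same implication applied to `¬θ`.
  refine ⟨r, hr, fun k θ b d hd => ⟨fun hb => by_contra fun hn => ?_, key k θ b d hd⟩⟩
  exact inst_not_mem_iff.1 (key k θ.not b d hd (inst_not_mem_iff.2 hn)) hb

/-- Solves `p ∗ q = r` for `p` as a limit of `τ_s⁻¹ · r`. The conjugates stay in the support, so
they are `M`-invariant and `τ_s⁻¹(b)` may be replaced by `d`. -/
theorem IsMonster.exists_left_factor (hC : IsMonster L C κ)
    (hI : Cardinal.lift.{max u v} #(n '' I) < κ) (hsupp : μ.support ⊆ invTypes L n I)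
    (hstab : stabL μ = relDefGroup n I π) (htrans : μ.support ⊆ partialTypeSet n I π)
    {r q : GlobalTypes L n} (hr : r ∈ μ.support) (hq : q ∈ μ.support) :
    ∃ p ∈ μ.support, ∀ (k : ℕ) (θ : L.Formula (ι ⊕ Fin k)) (b d : Fin k → C),
      RealizesRes I b q d → inst θ b ∈ r.1 → inst θ d ∈ p.1 := by
  choose τ hτ hres using hC.exists_relDefGroup hI (htrans hq)
  choose f hf using fun s => exists_conj (τ s).symm r
  have hfs : ∀ s, f s ∈ μ.support := fun s =>
    mem_support_of_eval_comp (fun k θ b => by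
      -- Evaluating at `τ_s(b)` shows that `τ_s⁻¹` stabilizes `μ` too.
      have h1 := (hstab ▸ hτ s : τ s ∈ stabL μ) k θ (τ s ∘ b)
      rw [FirstOrder.Language.Equiv.symm_symm, ← h1]
      congr 1
      ext i
      simp) hr (hf s)
  obtain ⟨p, hp, h⟩ := exists_limit_mem_support f hfs
  refine ⟨p, hp, fun k θ b d hd hθ => h k θ d ?_⟩
  classical
  filter_upwards [Filter.eventually_ge_atTop (Finset.univ.image b)] with s hs
  refine (hC.inst_mem_iff_of_mem_invTypes hI (hsupp (hfs s)) ((hres s k b fun i =>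
      hs (Finset.mem_image_of_mem b (Finset.mem_univ i))).sameType hd) θ).1 ?_
  rw [hf]
  convert hθ
  ext i
  simp

end Support

end StarProduct

end

/-! ### The semigroup structure and left simplicity -/

theorem mainTheorem10
    {L : FirstOrder.Language.{u, v}} {C : Type w} [L.Structure C] [Nonempty C]
    (κ : Cardinal.{max u v w}) (hC : StarProduct.IsMonster L C κ)
    (M N : L.ElementarySubstructure C)
    (hM : Cardinal.lift.{max u v} (Cardinal.mk (M : Set C)) < κ)
    {ι : Type z} (n : ι → C) (hN : Set.range n = (N : Set C))
    (I : Set ι) (hI : n '' I = (M : Set C))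
    (μ : MeasureTheory.Measure (StarProduct.GlobalTypes L n))
    [MeasureTheory.IsProbabilityMeasure μ] [μ.Regular]
    (hdef : StarProduct.IsDefinableOver I μ)
    (hsupp : μ.support ⊆ StarProduct.invTypes L n I)
    (hidem : StarProduct.IsIdempotent I μ)
    (π : Set (L.Formula (I ⊕ I)))
    (hπ : ∀ a b : I → C, (∀ φ ∈ π, φ.Realize (Sum.elim a b)) →
      StarProduct.tpEmpty L a = StarProduct.tpEmpty L b)
    (hstab : StarProduct.stabL μ = StarProduct.relDefGroup n I π)
    (htrans : μ.support ⊆ StarProduct.partialTypeSet n I π) :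
    ∃ _ : Semigroup μ.support,
      (∀ p q : μ.support, StarProduct.IsStarProduct I p.1 q.1 (p * q).1) ∧
      StarProduct.IsLeftSimple μ.support := by
  have hsm : Cardinal.lift.{max u v} #(n '' I) < κ := by rw [hI]; exact hM
  have hex : ∀ p q : μ.support, ∃ r : μ.support,
      ∀ (k : ℕ) (θ : L.Formula (ι ⊕ Fin k)) (b d : Fin k → C),
        StarProduct.RealizesRes I b q.1 d →
          (StarProduct.inst θ b ∈ r.1.1 ↔ StarProduct.inst θ d ∈ p.1.1) := fun p q => by
    obtain ⟨r, hr, h⟩ := hC.exists_star_mem_support hsm hsupp hstab htrans p.2 q.2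
    exact ⟨⟨r, hr⟩, h⟩
  choose star hstar using hex
  have hassoc : ∀ p q r : μ.support, star (star p q) r = star p (star q r) := fun p q r => by
    refine Subtype.ext (StarProduct.GlobalTypes.ext_inst fun k θ b hb => ?_)
    obtain ⟨d, hd⟩ := hC.exists_realizesRes hsm b r.1
    obtain ⟨e, he⟩ := hC.exists_realizesRes hsm d q.1
    -- If `d` realizes `h_b(r)|_M` and `e` realizes `h_d(q)|_M`, then `e` realizes `h_b(q ∗ r)|_M`;
    -- both bracketings thus test `θ(x; e) ∈ p`.
    have he' : StarProduct.RealizesRes I b (star q r).1 e := fun ψ =>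
      (he ψ).trans (hstar q r k _ b d hd).symm
    rwa [hstar _ _ k θ b e he', ← hstar p q k θ d e he, ← hstar _ r k θ b d hd]
  refine ⟨{ mul := star, mul_assoc := hassoc }, fun p q k θ b => ?_, fun J hJ hJl => ?_⟩
  · simp only [StarProduct.tpOver_eq_hTypeRes_iff]
    constructor
    · intro hb
      obtain ⟨d, hd⟩ := hC.exists_realizesRes hsm b q.1
      exact ⟨d, hd, (hstar p q k θ b d hd).1 hb⟩
    · rintro ⟨d, hd, hθ⟩
      exact (hstar p q k θ b d hd).2 hθ
  · obtain ⟨t, ht⟩ := hJ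
    refine Set.eq_univ_of_forall fun r => ?_
    -- Any `r` is a left multiple of `t`, so a left ideal containing `t` is everything.
    obtain ⟨p, hp, h⟩ := hC.exists_left_factor hsm hsupp hstab htrans r.2 t.2
    have hr : r = star ⟨p, hp⟩ t := by
      refine Subtype.ext (StarProduct.GlobalTypes.ext_inst fun k θ b hb => ?_)
      obtain ⟨d, hd⟩ := hC.exists_realizesRes hsm b t.1
      exact (hstar _ t k θ b d hd).2 (h k θ b d hd hb)
    rw [hr]
    exact hJl ⟨p, hp⟩ t ht
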